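/- For integers $k\ge 0$ and $N\ge 1$ let $M_k(N)$ be the complex vector space of modular forms of weight $k$ for $\Gamma_0(N)=\{\begin{pmatrix}a&b\\c&d\end{pmatrix}\in \mathrm{SL}_2(\mathbb Z): N\mid c\}$, and let $M(N)=\bigoplus_{k\ge 0}M_k(N)$ be the graded $\mathbb C$-algebra of modular forms. With $q=e^{2\pi i z}$ and $\sigma_m(n)=\sum_{d\mid n}d^m$, put $$E_2=1-24\sum_{n\ge1}\sigma_1(n)q^n,\quad E_4=1+240\sum_{n\ge1}\sigma_3(n)q^n,\quad E_6=1-504\sum_{n\ge1}\sigma_5(n)q^n,$$ and, for $N>1$, $$C_N(z)=\frac{N E_2(Nz)-E_2(z)}{\gcd(N-1,24)},\qquad \alpha_2(z)=\frac{E_4(z)-E_4(2z)}{240},\qquad \alpha_4=\frac{C_2-C_4}{16}.$$ For $f\in M_a(N)$ and $g\in M_b(N)$ write $M(N)\simeq\mathbb C[f,g]^{[a,b]}$ if the $\mathbb C$-algebra homomorphism $\mathbb C[X,Y]\to M(N)$ with $X\mapsto f$, $Y\mapsto g$ is an isomorphism of graded algebras, where $X$ has degree $a$ and $Y$ has degree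 $b$. **Theorem 1.** 1. $E_4\in M_4(1)$, $E_6\in M_6(1)$, and $M(1)\simeq\mathbb C[E_4,E_6]^{[4,6]}$. 2. $C_2\in M_2(2)$, $\alpha_2,E_4\in M_4(2)$, and $M(2)\simeq\mathbb C[C_2,\alpha_2]^{[2,4]}$ and $M(2)\simeq\mathbb C[C_2,E_4]^{[2,4]}$; moreover the subalgebras $\mathbb C[C_2,\alpha_2]$ and $\mathbb C[C_2,E_4]$ of $M(2)$ are equal. 3. $C_2,\alpha_4,C_4\in M_2(4)$, and $M(4)\simeq\mathbb C[C_2,\alpha_4]^{[2,2]}$ and $M(4)\simeq\mathbb C[C_2,C_4]^{[2,2]}$; moreover the subalgebras $\mathbb C[C_2,\alpha_4]$ and $\mathbb C[C_2,C_4]$ of $M(4)$ are equal. -/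

import Mathlib

open scoped DirectSum MatrixGroups
open UpperHalfPlane CongruenceSubgroup

noncomputable section

namespace SmallLevel

/-- The space of modular forms of weight `k ≥ 0` for `Γ₀(N)`. -/
abbrev M (N k : ℕ) : Type := ModularForm (Gamma0 N : Subgroup (GL (Fin 2) ℝ)) (k : ℤ)

/-! The multiplication on `⨁ k ≥ 0, M N k` induced by the pointwise product of modular forms,
with `ℂ` mapping to the constant functions in weight `0`. -/

/-- The form `1` of weight `0`, and products `M N k × M N l → M N (k + l)`. -/
instance instGOne (N : ℕ) : GradedMonoid.GOne (M N) where
  one := ModularForm.mcast Nat.cast_zero.symm 1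

instance instGMul (N : ℕ) : GradedMonoid.GMul (M N) where
  mul {k l} f g := ModularForm.mcast (Nat.cast_add k l).symm (ModularForm.mul f g)

theorem gradedMonoid_ext {N : ℕ} {a b : GradedMonoid (M N)} (h : a.1 = b.1)
    (h' : ∀ z, a.2 z = b.2 z) : a = b := by
  obtain ⟨k, f⟩ := a
  obtain ⟨l, g⟩ := b
  obtain rfl : k = l := h
  exact congrArg _ (ModularForm.ext h')

instance instGCommRing (N : ℕ) : DirectSum.GCommRing (M N) where
  one_mul _ := gradedMonoid_ext (zero_add _) fun _ => one_mul _
  mul_one _ := gradedMonoid_ext (add_zero _) fun _ => mul_one _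
  mul_assoc _ _ _ := gradedMonoid_ext (add_assoc _ _ _) fun _ => mul_assoc _ _ _
  mul_comm _ _ := gradedMonoid_ext (add_comm _ _) fun _ => mul_comm _ _
  mul_zero _ := ModularForm.ext fun _ => mul_zero _
  zero_mul _ := ModularForm.ext fun _ => zero_mul _
  mul_add _ _ _ := ModularForm.ext fun _ => mul_add _ _ _
  add_mul _ _ _ := ModularForm.ext fun _ => add_mul _ _ _
  natCast n := ModularForm.mcast Nat.cast_zero.symm (n : ModularForm _ 0)
  natCast_zero := ModularForm.ext fun _ => Nat.cast_zero
  natCast_succ _ := ModularForm.ext fun _ => Nat.cast_succ _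
  intCast n := ModularForm.mcast Nat.cast_zero.symm (n : ModularForm _ 0)
  intCast_ofNat _ := ModularForm.ext fun _ => AddGroupWithOne.intCast_ofNat _
  intCast_negSucc_ofNat _ := ModularForm.ext fun _ => AddGroupWithOne.intCast_negSucc _

instance instGAlgebra (N : ℕ) : DirectSum.GAlgebra ℂ (M N) where
  toFun :=
    { toFun c := ModularForm.mcast Nat.cast_zero.symm (ModularForm.const c)
      map_zero' := rfl
      map_add' _ _ := rfl }
  map_one := rfl
  map_mul _ _ := gradedMonoid_ext (zero_add 0).symm fun _ => rfl
  commutes _ _ := gradedMonoid_ext (add_comm _ _) fun _ => mul_comm _ _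
  smul_def _ _ := gradedMonoid_ext (zero_add _).symm fun _ => rfl

/-- The graded ring `M(N) = ⨁_{k ≥ 0} M_k(N)` of modular forms for `Γ₀(N)`, a commutative
`ℂ`-algebra. -/
abbrev GradedRing (N : ℕ) : Type := ⨁ k : ℕ, M N k

/-- The function `f^{(h)}(z) = f(h z)`, that is `f(q) ↦ f(q^h)` on Fourier expansions. -/
def levelRaise (h : ℕ) [NeZero h] (f : ℍ → ℂ) (z : ℍ) : ℂ :=
  f ⟨(h : ℂ) * z, by
    simpa using mul_pos (Nat.cast_pos.2 (Nat.pos_of_ne_zero (NeZero.ne h))) z.im_pos⟩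

/-- `E₂ = 1 - 24 ∑ σ₁(n) qⁿ`. -/
def E2 : ℍ → ℂ := EisensteinSeries.E2

/-- `E₄ = 1 + 240 ∑ σ₃(n) qⁿ`. -/
def E4 : ℍ → ℂ := ⇑ModularForm.E₄

/-- `E₆ = 1 - 504 ∑ σ₅(n) qⁿ`. -/
def E6 : ℍ → ℂ := ⇑ModularForm.E₆

/-- `C_N = (N E₂(q^N) - E₂) / gcd(N - 1, 24)`, for `N > 1`. -/
def C (N : ℕ) [NeZero N] (z : ℍ) : ℂ :=
  ((N : ℂ) * levelRaise N E2 z - E2 z) / (Nat.gcd (N - 1) 24 : ℂ)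

/-- `α₂ = (E₄ - E₄(q²)) / 240`. -/
def alpha2 (z : ℍ) : ℂ := (E4 z - levelRaise 2 E4 z) / 240

/-- `α₄ = (C₂ - C₄) / 16`. -/
def alpha4 (z : ℍ) : ℂ := (C 2 z - C 4 z) / 16

/-- `M(N) ≃ ℂ[f, g]^{[a, b]}`: for `f` of weight `a` and `g` of weight `b`, the homomorphism
of `ℂ`-algebras from the polynomial ring `ℂ[X, Y]`, graded by `deg X = a` and `deg Y = b`, to
`M(N)` that sends `X` to `f` and `Y` to `g` is an isomorphism of graded algebras. -/
def IsGradedPolynomialRing (N : ℕ) {a b : ℕ} (f : M N a) (g : M N b) : Prop :=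
  ∃ e : MvPolynomial (Fin 2) ℂ ≃ₐ[ℂ] GradedRing N,
    e (MvPolynomial.X 0) = DirectSum.of (M N) a f ∧
    e (MvPolynomial.X 1) = DirectSum.of (M N) b g ∧
    ∀ k : ℕ, (MvPolynomial.weightedHomogeneousSubmodule ℂ ![a, b] k).map e.toLinearMap =
      LinearMap.range (DirectSum.lof ℂ ℕ (M N) k)

/-- The subalgebra `ℂ[f, g]` of `M(N)` generated by the forms `f` and `g`. -/
def generated (N : ℕ) {a b : ℕ} (f : M N a) (g : M N b) : Subalgebra ℂ (GradedRing N) :=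
  Algebra.adjoin ℂ {DirectSum.of (M N) a f, DirectSum.of (M N) b g}

end SmallLevel

end

/-!
The ring of modular forms of level `N = 1, 2, 4` is generated by two forms because there is a form
`D` (namely `Δ`, `α₂`, `α₄`, of weights 12, 4, 2) with no zero other than a simple one at the cusp
infinity. In all three cases the weight of `D` times the index of `Γ₀(N)` is 12. The product of the
conjugates of `D` (its norm to level one) is therefore a nonzero cusp form of weight 12 and level
one, that is a multiple of the discriminant, which has no zero in the upper half-plane and decays
exactly like `q`. So `f / D` is a modular form for every form `f` that vanishes at infinity
(`exists_eq_mul_of_isZeroAtImInfty`). Generation follows by induction on the weight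
(`eq_top_of_division`): the generators have monomials with value 1 at infinity in every weight in
which there are nonzero forms; subtracting a multiple of such a monomial from `f` makes it vanish
at infinity, and then it is divided by `D`. For level one, the induction also needs that there is
no form of weight two.

Two forms `f`, `g` of weights `a`, `b` satisfying a weighted homogeneous relation satisfy one of the
form `f ^ b = c g ^ a`, because `f ^ b / g ^ a` takes only finitely many values
(`eq_zero_of_eval_eq_zero`). Together with the comparison of gradings this gives the criterion
`isGradedPolynomialRing_of_generated_eq_top`. For the levels two and four, relations
`f ^ b = c g ^ a` are excluded by the values of the forms at the cusps infinity and zero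
(`HasValues`), which are computed from the transformation of `E₂` and `E₄` under `z ↦ -1/z`; for
level one, such a relation would give `E₄³ = -E₆²`, contradicting the values at infinity.

The second pair of generators yields the first: at level two, the division theorem gives
`E₄ - C₂² = 192 α₂`, where the constant is read off at the cusp zero, and `α₄ = (C₂ - C₄) / 16` by
definition.
-/

noncomputable section

namespace SmallLevel

section

open MvPolynomial Filter Topology Manifold

/-! ### Graded polynomial rings of modular forms -/

/-- The value at `z` of a (non-homogeneous) element of the ring of modular forms. -/
def evalAt (N : ℕ) (z : ℍ) : GradedRing N →ₐ[ℂ] ℂ :=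
  DirectSum.toAlgebra ℂ (M N)
    (fun _ => { toFun := fun f => f z, map_add' := fun _ _ => rfl, map_smul' := fun _ _ => rfl })
    rfl fun _ _ => rfl

@[simp]
lemma evalAt_of {N k : ℕ} (z : ℍ) (f : M N k) : evalAt N z (DirectSum.of (M N) k f) = f z :=
  DirectSum.toAddMonoid_of (fun _ : ℕ => AddMonoidHom.mk' (fun f : M N _ => f z) fun _ _ => rfl) k f

lemma algebraMap_eq_of {N : ℕ} (c : ℂ) : ∃ f : M N 0,
    (∀ z, f z = c) ∧ algebraMap ℂ (GradedRing N) c = DirectSum.of (M N) 0 f :=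
  ⟨ModularForm.mcast Nat.cast_zero.symm (ModularForm.const c), fun _ => rfl, rfl⟩

lemma exists_of_eq_mul {N k l : ℕ} (f : M N k) (g : M N l) : ∃ h : M N (k + l),
    (∀ z, h z = f z * g z) ∧
      DirectSum.of (M N) (k + l) h = DirectSum.of (M N) k f * DirectSum.of (M N) l g := by
  refine ⟨GradedMonoid.GMul.mul f g, fun _ => rfl, (DirectSum.of_mul_of ..).symm⟩

lemma exists_of_eq_pow {N k : ℕ} (f : M N k) (n : ℕ) : ∃ h : M N (n * k),
    (∀ z, h z = f z ^ n) ∧ DirectSum.of (M N) (n * k) h = DirectSum.of (M N) k f ^ n := by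
  have h := DirectSum.ofPow (A := M N) f n
  exact ⟨_, fun z => (evalAt_of z _).symm.trans <| by
    rw [← evalAt_of z f, ← map_pow, h]; rfl, h.symm⟩

section Independence

variable {a b : ℕ}

lemma weight_pair (d : Fin 2 →₀ ℕ) : Finsupp.weight ![a, b] d = d 0 * a + d 1 * b := by
  simp [Finsupp.weight_apply, Finsupp.sum_fintype]

lemma eval_pair (x y : ℂ) (P : MvPolynomial (Fin 2) ℂ) :
    eval ![x, y] P = ∑ d ∈ P.support, coeff d P * (x ^ d 0 * y ^ d 1) := by
  simp [eval_eq']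

lemma eval_weighted_smul {k : ℕ} {P : MvPolynomial (Fin 2) ℂ}
    (hP : P.IsWeightedHomogeneous ![a, b] k) (l x y : ℂ) :
    eval ![l ^ a * x, l ^ b * y] P = l ^ k * eval ![x, y] P := by
  rw [eval_pair, eval_pair, Finset.mul_sum]
  refine Finset.sum_congr rfl fun d hd => ?_
  have hk := hP (mem_support_iff.mp hd)
  rw [weight_pair] at hk
  rw [← hk]
  ring

/-- A nonzero weighted homogeneous polynomial in `X, Y` becomes a nonzero polynomial in `X` after
setting `Y = 1`, so it has finitely many zeros of the form `(x, 1)`. -/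
lemma finite_eval_one_eq_zero (hb : 0 < b) {k : ℕ} {P : MvPolynomial (Fin 2) ℂ}
    (hP : P.IsWeightedHomogeneous ![a, b] k) (hP0 : P ≠ 0) :
    ∃ s : Finset ℂ, ∀ x, eval ![x, 1] P = 0 → x ∈ s := by
  let p : Polynomial ℂ := ∑ d ∈ P.support, Polynomial.C (coeff d P) * Polynomial.X ^ d 0
  obtain ⟨d, hd⟩ : ∃ d, coeff d P ≠ 0 := by
    simpa [eq_zero_iff] using hP0
  have hp : p ≠ 0 := by
    intro h
    have hc : p.coeff (d 0) = coeff d P := by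
      simp only [p, Polynomial.finsetSum_coeff, Polynomial.coeff_C_mul_X_pow]
      refine (Finset.sum_eq_single d (fun e he hed => if_neg fun h0 => hed ?_) fun h => ?_).trans
        (by simp)
      · have h1 := hP hd
        have h2 := hP (mem_support_iff.mp he)
        rw [weight_pair] at h1 h2
        rw [← h0] at h2
        have h3 : e 1 = d 1 := Nat.eq_of_mul_eq_mul_right hb (by omega)
        ext i
        fin_cases i
        · exact h0.symm
        · exact h3
      · simpa using h
    exact hd (by simpa [h] using hc.symm)
  refine ⟨p.roots.toFinset, fun x hx => ?_⟩
  rw [Multiset.mem_toFinset, Polynomial.mem_roots hp, Polynomial.IsRoot, ← hx, eval_pair]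
  simp [p, Polynomial.eval_finsetSum]

/-- If `f` and `g` satisfy a weighted homogeneous relation, then `f ^ b / g ^ a` takes finitely
many values, hence is constant. -/
lemma eq_zero_of_eval_eq_zero (hb : 0 < b) {f g : ℍ → ℂ} (hf : MDiff f) (hg : MDiff g)
    (hg0 : g ≠ 0) (hfg : ∀ c : ℂ, f ^ b ≠ c • g ^ a) {k : ℕ} {P : MvPolynomial (Fin 2) ℂ}
    (hP : P.IsWeightedHomogeneous ![a, b] k) (h : ∀ z, eval ![f z, g z] P = 0) : P = 0 := by
  by_contra hP0
  obtain ⟨s, hs⟩ := finite_eval_one_eq_zero hb hP hP0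
  have hdiff : ∀ t : ℂ, MDiff (f ^ b - t ^ b • g ^ a) := fun t =>
    (hf.pow b).sub ((hg.pow a).const_smul _)
  have hprod : g * ∏ t ∈ s, (f ^ b - t ^ b • g ^ a) = 0 := by
    ext z
    simp only [Pi.mul_apply, Finset.prod_apply, Pi.zero_apply, Pi.sub_apply, Pi.pow_apply,
      Pi.smul_apply, smul_eq_mul]
    rcases eq_or_ne (g z) 0 with h0 | h0
    · simp [h0]
    · -- Scaling by `l` makes the second coordinate 1.
      obtain ⟨l, hl⟩ := IsAlgClosed.exists_pow_nat_eq (g z)⁻¹ hb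
      refine mul_eq_zero_of_right _ (Finset.prod_eq_zero (hs (l ^ a * f z) ?_) ?_)
      · have := eval_weighted_smul hP l (f z) (g z)
        rwa [h z, mul_zero, hl, inv_mul_cancel₀ h0] at this
      · have h1 : (l ^ a * f z) ^ b = (g z)⁻¹ ^ a * f z ^ b := by rw [← hl]; ring
        rw [h1, inv_pow]
        field_simp
        ring
  rcases (mul_eq_zero_iff hg (MDifferentiable.prod fun t _ => hdiff t)).mp hprod with h0 | h0
  · exact hg0 h0
  · obtain ⟨t, -, ht⟩ := (prod_eq_zero_iff fun t _ => hdiff t).mp h0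
    exact hfg (t ^ b) (sub_eq_zero.mp ht)

end Independence

/-- The homomorphism `X ↦ f`, `Y ↦ g` maps the homogeneous component of degree `k` of `P` to the
component of weight `k` of the image of `P`. -/
lemma aeval_weightedHomogeneousComponent {N a b : ℕ} (f : M N a) (g : M N b) (k : ℕ)
    (P : MvPolynomial (Fin 2) ℂ) :
    aeval ![DirectSum.of (M N) a f, DirectSum.of (M N) b g]
        (weightedHomogeneousComponent ![a, b] k P) =
      DirectSum.of (M N) k
        ((aeval ![DirectSum.of (M N) a f, DirectSum.of (M N) b g] P : GradedRing N) k) := by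
  induction P using MvPolynomial.induction_on' with
  | add p q hp hq => rw [map_add, map_add, hp, hq, map_add, DirectSum.add_apply, map_add]
  | monomial d c =>
    have key : ∃ h : M N (d 0 * a + d 1 * b),
        aeval ![DirectSum.of (M N) a f, DirectSum.of (M N) b g] (monomial d c) =
          DirectSum.of (M N) (d 0 * a + d 1 * b) h := by
      obtain ⟨u, -, hu⟩ := exists_of_eq_pow f (d 0)
      obtain ⟨v, -, hv⟩ := exists_of_eq_pow g (d 1)
      obtain ⟨w, -, hw⟩ := exists_of_eq_mul u v
      refine ⟨c • w, ?_⟩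
      rw [DirectSum.of_smul, hw, hu, hv, aeval_monomial,
        Finsupp.prod_fintype _ _ (fun _ => pow_zero _), Algebra.smul_def]
      simp
    obtain ⟨h, hh⟩ := key
    have hd := isWeightedHomogeneous_monomial ![a, b] d c (weight_pair d)
    rcases eq_or_ne k (d 0 * a + d 1 * b) with rfl | hk
    · rw [hd.weightedHomogeneousComponent_same, hh, DirectSum.of_eq_same]
    · rw [hd.weightedHomogeneousComponent_ne _ hk, hh, DirectSum.of_eq_of_ne _ _ _ hk, map_zero,
        map_zero]

/-- Two generators of the ring of modular forms without an algebraic relation of the special form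
`f ^ b = c g ^ a` are algebraically independent. -/
theorem isGradedPolynomialRing_of_generated_eq_top {N a b : ℕ} (hb : 0 < b) (f : M N a) (g : M N b)
    (hgen : generated N f g = ⊤) (hg0 : g ≠ 0) (hfg : ∀ c : ℂ, (⇑f) ^ b ≠ c • (⇑g) ^ a) :
    IsGradedPolynomialRing N f g := by
  set φ : MvPolynomial (Fin 2) ℂ →ₐ[ℂ] GradedRing N :=
    aeval ![DirectSum.of (M N) a f, DirectSum.of (M N) b g] with hφ
  have hcomp : ∀ k P, φ (weightedHomogeneousComponent ![a, b] k P) =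
    DirectSum.of (M N) k (φ P k) := aeval_weightedHomogeneousComponent f g
  have hev : ∀ z P, evalAt N z (φ P) = eval ![f z, g z] P := by
    intro z P
    have : (evalAt N z).comp φ = aeval ![f z, g z] := by
      ext i
      fin_cases i <;> simp [hφ]
    rw [← AlgHom.comp_apply, this, aeval_eq_eval]
  have hinj : Function.Injective φ := by
    rw [injective_iff_map_eq_zero]
    intro P hP
    rw [← sum_weightedHomogeneousComponent ![a, b] P]
    refine finsum_eq_zero_of_forall_eq_zero fun k => ?_
    refine eq_zero_of_eval_eq_zero hb (ModularFormClass.holo f) (ModularFormClass.holo g)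
      (fun h => hg0 (DFunLike.coe_injective h)) hfg
      (weightedHomogeneousComponent_isWeightedHomogeneous k P) fun z => ?_
    rw [← hev, hcomp, hP, DirectSum.zero_apply, map_zero, map_zero]
  have hsurj : Function.Surjective φ := by
    rw [← AlgHom.range_eq_top, hφ, ← Algebra.adjoin_range_eq_range_aeval, ← hgen, generated,
      Matrix.range_cons_cons_empty]
  refine ⟨AlgEquiv.ofBijective φ ⟨hinj, hsurj⟩, by simp [hφ], by simp [hφ], fun k => ?_⟩
  ext x
  simp only [Submodule.mem_map, mem_weightedHomogeneousSubmodule, LinearMap.mem_range,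
    DirectSum.lof_eq_of]
  constructor
  · rintro ⟨P, hP, rfl⟩
    exact ⟨φ P k, by rw [← hcomp, hP.weightedHomogeneousComponent_same]; rfl⟩
  · rintro ⟨h, rfl⟩
    obtain ⟨P, hP⟩ := hsurj (DirectSum.of (M N) k h)
    refine ⟨_, weightedHomogeneousComponent_isWeightedHomogeneous k P, (hcomp k P).trans ?_⟩
    rw [hP, DirectSum.of_eq_same]

end

open Filter Topology Manifold ModularForm Matrix.SpecialLinearGroup Asymptotics SlashInvariantForm

/-! ### Division by a form with a simple zero at infinity -/

/-- The cosets `SL₂(ℤ) / Γ₀(N)`, as subgroups of `GL₂(ℝ)`. These index the conjugates of a form of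
level `N`, whose product is its norm to level one. -/
abbrev Cosets (N : ℕ) : Type :=
  𝒮ℒ ⧸ ((Gamma0 N : Subgroup (GL (Fin 2) ℝ)).subgroupOf 𝒮ℒ)

lemma one_mem_strictPeriods_Gamma0 (N : ℕ) :
    (1 : ℝ) ∈ (Gamma0 N : Subgroup (GL (Fin 2) ℝ)).strictPeriods := by simp

section Division

variable {N : ℕ} [NeZero N] {k w : ℤ}

lemma isBigO_exp_of_isZeroAtImInfty (f : ModularForm (Gamma0 N : Subgroup (GL (Fin 2) ℝ)) k)
    (hf : IsZeroAtImInfty f) : f =O[atImInfty] fun τ => Real.exp (-2 * Real.pi * τ.im) := by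
  simpa using hf.exp_decay_atImInfty one_pos
    (SlashInvariantFormClass.periodic_comp_ofComplex f (one_mem_strictPeriods_Gamma0 N))
    (ModularFormClass.holo f) (ModularFormClass.bdd_at_infty f)

lemma quotientFunc_isBoundedAtImInfty
    (f : ModularForm (Gamma0 N : Subgroup (GL (Fin 2) ℝ)) k) (q : Cosets N) :
    IsBoundedAtImInfty (quotientFunc f q) := by
  induction q using Quotient.inductionOn with
  | h r =>
    obtain ⟨r, γ, rfl⟩ := r
    rw [quotientFunc_mk]
    rw [← map_inv]
    exact ModularFormClass.bdd_at_infty_slash f γ⁻¹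

/-- The factor at the trivial coset makes the norm of `D` decay like `exp (2πiτ)`. The same holds if
the factor at any one coset `q` is replaced by the conjugate of a form `f` vanishing at infinity:
for the trivial coset it is then `f` that decays. -/
lemma quotientFunc_mul_prod_isBigO [Fintype (Cosets N)] [DecidableEq (Cosets N)]
    (f : ModularForm (Gamma0 N : Subgroup (GL (Fin 2) ℝ)) k)
    (D : ModularForm (Gamma0 N : Subgroup (GL (Fin 2) ℝ)) w)
    (hf : IsZeroAtImInfty f) (hD : IsZeroAtImInfty D) (q : Cosets N) :
    (quotientFunc f q * ∏ p ∈ Finset.univ.erase q, quotientFunc D p) =O[atImInfty]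
      fun τ => Real.exp (-2 * Real.pi * τ.im) := by
  have hone {l : ℤ} (g : ModularForm (Gamma0 N : Subgroup (GL (Fin 2) ℝ)) l) :
      quotientFunc g (⟦1⟧ : Cosets N) = g := by
    simp [quotientFunc_mk]
  have hbdd (s : Finset (Cosets N)) : (∏ p ∈ s, quotientFunc D p) =O[atImInfty] (1 : ℍ → ℝ) := by
    have := IsBigO.finsetProd (s := s) (l := atImInfty) (f := fun p => quotientFunc D p)
      (g := fun _ => (1 : ℍ → ℝ)) fun p _ => quotientFunc_isBoundedAtImInfty D p
    simpa [Finset.prod_fn, Pi.one_def] using! this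
  by_cases hq : q = ⟦1⟧
  · subst hq
    rw [hone]
    exact ((isBigO_exp_of_isZeroAtImInfty f hf).mul (hbdd (Finset.univ.erase ⟦1⟧))).congr_right
      fun _ => mul_one _
  · rw [← Finset.mul_prod_erase _ _ (Finset.mem_erase.mpr ⟨Ne.symm hq, Finset.mem_univ _⟩), hone]
    exact (IsBigO.mul (quotientFunc_isBoundedAtImInfty f q)
      ((isBigO_exp_of_isZeroAtImInfty D hD).mul
        (hbdd ((Finset.univ.erase q).erase ⟦1⟧)))).congr_right
      fun _ => by simp

/-- The norm to level one of a form `D ≠ 0` vanishing at infinity is a cusp form. When its weight is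
at most 12, it is therefore a multiple of the discriminant. -/
lemma exists_norm_eq_mul_discriminant
    (D : ModularForm (Gamma0 N : Subgroup (GL (Fin 2) ℝ)) w) (hD0 : D ≠ 0)
    (hD : IsZeroAtImInfty D) (hw : w * Nat.card (Cosets N) ≤ 12) :
    ∃ c : ℂ, c ≠ 0 ∧ ∀ z, ModularForm.norm 𝒮ℒ D z = c * discriminant z := by
  have hne : ModularForm.norm 𝒮ℒ D ≠ 0 :=
    ModularForm.norm_ne_zero 𝒮ℒ fun h => hD0 (DFunLike.coe_injective h)
  let := Fintype.ofFinite (Cosets N)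
  classical
  have hzero : IsZeroAtImInfty (ModularForm.norm 𝒮ℒ D) := by
    obtain ⟨q⟩ : Nonempty (Cosets N) := ⟨⟦1⟧⟩
    have h := quotientFunc_mul_prod_isBigO D D hD hD q
    refine IsBigO.trans_tendsto (g'' := fun τ : ℍ => Real.exp (-2 * Real.pi * τ.im)) ?_ ?_
    · rw [ModularForm.coe_norm, ← Finset.mul_prod_erase _ _ (Finset.mem_univ q)]
      exact h
    · refine Real.tendsto_exp_atBot.comp ?_
      exact tendsto_comap.const_mul_atTop_of_neg (by linarith [Real.pi_pos])
  have hcoeff : (qExpansion 1 (ModularForm.norm 𝒮ℒ D)).coeff 0 = 0 := by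
    rw [qExpansion_coeff_zero one_pos
      (ModularFormClass.analyticAt_cuspFunction_zero _ one_pos one_mem_strictPeriods_SL)
      (SlashInvariantFormClass.periodic_comp_ofComplex _ one_mem_strictPeriods_SL)]
    exact hzero.valueAtInfty_eq_zero
  set g := toCuspForm (ModularForm.norm 𝒮ℒ D) hcoeff with hg
  have hgz : ∀ z, g z = ModularForm.norm 𝒮ℒ D z := fun z => rfl
  have hg0 : g ≠ 0 := fun h => hne (ModularForm.ext fun z => by rw [← hgz, h]; rfl)
  rcases hw.lt_or_eq with hlt | heq
  · have hrank := CuspForm.rank_eq_zero_of_weight_lt_twelve hlt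
    exact absurd (rank_zero_iff_forall_zero.mp hrank g) hg0
  · obtain ⟨c, hc⟩ := CuspForm.exists_smul_discriminant_of_weight_eq_twelve (CuspForm.mcast heq g)
    have hcz : ∀ z, ModularForm.norm 𝒮ℒ D z = c * discriminant z := fun z =>
      (DFunLike.congr_fun hc z).symm
    refine ⟨c, ?_, hcz⟩
    rintro rfl
    exact hne (ModularForm.ext fun z => by rw [hcz, zero_mul]; rfl)

/-- A form `D ≠ 0` that vanishes at infinity and whose weight times the index of `Γ₀(N)` is at most
12 has no zero other than a simple one at infinity, so it divides every form vanishing there. -/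
theorem exists_eq_mul_of_isZeroAtImInfty
    (D : ModularForm (Gamma0 N : Subgroup (GL (Fin 2) ℝ)) w) (hD0 : D ≠ 0)
    (hD : IsZeroAtImInfty D) (hw : w * Nat.card (Cosets N) ≤ 12)
    (f : ModularForm (Gamma0 N : Subgroup (GL (Fin 2) ℝ)) k) (hf : IsZeroAtImInfty f) :
    ∃ g : ModularForm (Gamma0 N : Subgroup (GL (Fin 2) ℝ)) (k - w), ∀ z, f z = D z * g z := by
  obtain ⟨c, hc0, hc⟩ := exists_norm_eq_mul_discriminant D hD0 hD hw
  let := Fintype.ofFinite (Cosets N)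
  classical
  have hprod : ∀ (q : Cosets N) (z : ℍ), quotientFunc D q z *
      (∏ p ∈ Finset.univ.erase q, quotientFunc D p) z = c * discriminant z := by
    intro q z
    rw [← hc, ModularForm.coe_norm, ← Pi.mul_apply, Finset.mul_prod_erase _ _ (Finset.mem_univ _)]
  have hDq : ∀ (q : Cosets N) (z : ℍ), quotientFunc D q z ≠ 0 := fun q z h =>
    mul_ne_zero hc0 (discriminant_ne_zero z) (by rw [← hprod q z, h, zero_mul])
  have hDz : ∀ z, D z ≠ 0 := by
    intro z
    have := hDq ⟦1⟧ z
    simpa [quotientFunc_mk] using this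
  have hbdd : ∀ q : Cosets N, IsBoundedAtImInfty (quotientFunc f q / quotientFunc D q) := by
    intro q
    have h1 := (quotientFunc_mul_prod_isBigO f D hf hD q).trans exp_isBigO_discriminant
    have h2 : (fun z => quotientFunc f q z / quotientFunc D q z) = fun z => c⁻¹ *
        ((quotientFunc f q * ∏ p ∈ Finset.univ.erase q, quotientFunc D p) z / discriminant z) := by
      ext z
      have h3 := hprod q z
      have h4 := hDq q z
      have h5 := discriminant_ne_zero z
      rw [Pi.mul_apply]
      field_simp
      linear_combination (-quotientFunc f q z) * h3
    change (fun z => quotientFunc f q z / quotientFunc D q z) =O[atImInfty] (1 : ℍ → ℝ)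
    rw [h2]
    exact ((div_isBoundedUnder_of_isBigO h1).isBigO_one ℝ).const_mul_left _
  refine ⟨{ toFun := f / D
            slash_action_eq' := ?_
            holo' := f.holo'.div D.holo' hDz
            bdd_at_cusps' := ?_ }, fun z => (mul_div_cancel₀ _ (hDz z)).symm⟩
  · rintro _ ⟨γ, hγ, rfl⟩
    have hf' := SlashInvariantFormClass.slash_action_eq f _ (Subgroup.mem_map_of_mem (mapGL ℝ) hγ)
    have hD' := SlashInvariantFormClass.slash_action_eq D _ (Subgroup.mem_map_of_mem (mapGL ℝ) hγ)
    exact (div_slash_SL2 k w γ f D).trans (congrArg₂ (· / ·) hf' hD')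
  · intro x hx
    rw [Subgroup.IsArithmetic.isCusp_iff_isCusp_SL2Z] at hx
    rw [OnePoint.isBoundedAt_iff_forall_SL2Z hx]
    intro γ _
    have := hbdd ⟦⟨mapGL ℝ γ⁻¹, γ⁻¹, rfl⟩⟧
    rw [quotientFunc_mk, quotientFunc_mk] at this
    rw [div_slash_SL2]
    simpa [← map_inv] using! this

end Division

/-- The index of `Γ₀(N)` is at most the length of a list of matrices whose bottom rows represent all
points of the projective line over `ℤ/N`. -/
lemma card_quotient_Gamma0_le {N n : ℕ} (r : Fin n → SL(2, ℤ))
    (hr : ∀ a b c d : ZMod N, a * d - b * c = 1 → ∃ i, c * (r i 1 1 : ℤ) = d * (r i 1 0 : ℤ)) :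
    Nat.card (Cosets N) ≤ n := by
  change ((Gamma0 N : Subgroup (GL (Fin 2) ℝ)).relIndex 𝒮ℒ) ≤ n
  rw [← Subgroup.index_comap, Subgroup.comap_map_eq_self_of_injective mapGL_injective]
  have hsurj : Function.Surjective fun i => (((r i)⁻¹ : SL(2, ℤ)) : SL(2, ℤ) ⧸ Gamma0 N) := by
    intro q
    induction q using QuotientGroup.induction_on with
    | H γ =>
      have hdet := γ⁻¹.det_coe
      rw [Matrix.det_fin_two] at hdet
      obtain ⟨i, hi⟩ := hr (γ⁻¹ 0 0 : ℤ) (γ⁻¹ 0 1 : ℤ) (γ⁻¹ 1 0 : ℤ) (γ⁻¹ 1 1 : ℤ)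
        (by exact_mod_cast congrArg (Int.cast : ℤ → ZMod N) hdet)
      refine ⟨i, Eq.symm ?_⟩
      refine QuotientGroup.eq.mpr ?_
      rw [Gamma0_mem]
      have : (γ⁻¹ * (r i)⁻¹) 1 0 = γ⁻¹ 1 0 * r i 1 1 - γ⁻¹ 1 1 * r i 1 0 := by
        rw [Matrix.SpecialLinearGroup.coe_mul, Matrix.mul_apply, Fin.sum_univ_two,
          Matrix.SpecialLinearGroup.SL2_inv_expl (r i)]
        simp
        ring
      rw [this]
      push_cast
      rw [hi, sub_self]
  simpa [Subgroup.index] using Nat.card_le_card_of_surjective _ hsurj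

/-! ### Values at the cusps infinity and zero -/

/-- `f` tends to `u` at the cusp `∞`, and `f ∣[k] S` does to `v`; thus `v` is the value at the cusp
`0` of a form `f` of weight `k`. -/
def HasValues (k : ℤ) (f : ℍ → ℂ) (u v : ℂ) : Prop :=
  Tendsto f atImInfty (𝓝 u) ∧ Tendsto (f ∣[k] ModularGroup.S) atImInfty (𝓝 v)

namespace HasValues

variable {k : ℤ} {f g : ℍ → ℂ} {u v u' v' : ℂ}

lemma eq (hf : HasValues k f u v) (hf' : HasValues k f u' v') : u = u' ∧ v = v' :=
  ⟨tendsto_nhds_unique hf.1 hf'.1, tendsto_nhds_unique hf.2 hf'.2⟩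

lemma smul (c : ℂ) (hf : HasValues k f u v) : HasValues k (c • f) (c * u) (c * v) := by
  refine ⟨hf.1.const_smul c, ?_⟩
  rw [SL_smul_slash]
  exact hf.2.const_smul c

lemma sub (hf : HasValues k f u v) (hg : HasValues k g u' v') :
    HasValues k (f - g) (u - u') (v - v') := by
  refine ⟨hf.1.sub hg.1, ?_⟩
  rw [sub_eq_add_neg, SlashAction.add_slash, SlashAction.neg_slash, ← sub_eq_add_neg]
  exact hf.2.sub hg.2

lemma pow (hf : HasValues k f u v) (n : ℕ) : HasValues (n * k) (f ^ n) (u ^ n) (v ^ n) := by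
  refine ⟨hf.1.pow n, ?_⟩
  have : (f ^ n) ∣[(n * k : ℤ)] ModularGroup.S = (f ∣[k] ModularGroup.S) ^ n := by
    ext z
    rw [SL_slash_apply, Pi.pow_apply, Pi.pow_apply, SL_slash_apply, mul_pow, ← zpow_natCast,
      ← zpow_natCast, ← zpow_mul]
    congr 2
    ring
  rw [this]
  exact hf.2.pow n

end HasValues

lemma tendsto_atImInfty_of_im_eq {φ : ℍ → ℍ} {c : ℝ} (hc : 0 < c)
    (hφ : ∀ z, (φ z).im = c * z.im) : Tendsto φ atImInfty atImInfty := by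
  refine tendsto_comap_iff.mpr ?_
  refine (tendsto_comap.const_mul_atTop hc).congr fun z => ?_
  exact (hφ z).symm

/-- The point `z / h` of the upper half-plane. -/
def divNat (h : ℕ) [NeZero h] (z : ℍ) : ℍ :=
  ⟨(z : ℂ) / h, by
    simpa using div_pos z.im_pos (Nat.cast_pos.2 (Nat.pos_of_ne_zero (NeZero.ne h)))⟩

lemma levelRaise_slash_S (h : ℕ) [NeZero h] (k : ℤ) (f : ℍ → ℂ) (z : ℍ) :
    (levelRaise h f ∣[k] ModularGroup.S) z =
      (h : ℂ) ^ (-k) * (f ∣[k] ModularGroup.S) (divNat h z) := by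
  have h0 : (h : ℂ) ≠ 0 := Nat.cast_ne_zero.mpr (NeZero.ne h)
  have hz := z.ne_zero
  rw [slash_S_apply, slash_S_apply, levelRaise, mul_left_comm, ← mul_zpow]
  congr 2
  · ext
    simp only [divNat]
    field_simp
  · simp only [divNat]
    field_simp

lemma HasValues.levelRaise {k : ℤ} {f : ℍ → ℂ} {u v : ℂ} (h : ℕ) [NeZero h]
    (hf : HasValues k f u v) : HasValues k (levelRaise h f) u ((h : ℂ) ^ (-k) * v) := by
  have h0 : (0 : ℝ) < h := Nat.cast_pos.mpr (Nat.pos_of_ne_zero (NeZero.ne h))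
  constructor
  · refine hf.1.comp (tendsto_atImInfty_of_im_eq h0 fun z => ?_)
    change ((h : ℂ) * z).im = h * z.im
    simp
  · refine ((hf.2.comp (tendsto_atImInfty_of_im_eq (inv_pos.mpr h0) fun z => ?_)).const_mul
      ((h : ℂ) ^ (-k))).congr fun z => (levelRaise_slash_S h k f z).symm
    change ((z : ℂ) / h).im = (h : ℝ)⁻¹ * z.im
    rw [Complex.div_natCast_im, div_eq_inv_mul]
    rfl

/-- The constant term of the `q`-expansion is the limit at infinity, because `(f - c 0) / q` has a
`q`-expansion without negative exponents, too, hence is bounded. -/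
lemma tendsto_of_hasSum {f : ℍ → ℂ} {c : ℕ → ℂ}
    (hf : ∀ τ : ℍ, HasSum (fun m => c m • Function.Periodic.qParam 1 τ ^ m) (f τ)) :
    Tendsto f atImInfty (𝓝 (c 0)) := by
  have hg : IsBoundedAtImInfty fun τ : ℍ => (f τ - c 0) / Function.Periodic.qParam 1 τ := by
    refine isBoundedAtImInfty_of_hasSum_qExpansion (c := fun m => c (m + 1)) one_pos fun τ => ?_
    have h := ((hasSum_nat_add_iff' 1).mpr (hf τ)).div_const (Function.Periodic.qParam 1 τ)
    have hq : Function.Periodic.qParam 1 (τ : ℂ) ≠ 0 := Complex.exp_ne_zero _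
    convert! h using 1
    · ext m
      simp only [smul_eq_mul, pow_succ]
      field_simp
    · simp
  have h1 := (qParam_tendsto_atImInfty one_pos).zero_mul_isBoundedUnder_le
    (f := fun τ : ℍ => Function.Periodic.qParam 1 τ) (isBigO_one_iff ℝ |>.mp hg)
  have h2 := h1.const_add (c 0)
  rw [add_zero] at h2
  refine h2.congr fun τ => ?_
  have hq : Function.Periodic.qParam 1 (τ : ℂ) ≠ 0 := Complex.exp_ne_zero _
  field_simp
  ring

lemma tendsto_inv_coe_atImInfty : Tendsto (fun z : ℍ => (z : ℂ)⁻¹) atImInfty (𝓝 0) := by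
  refine squeeze_zero_norm (a := fun z : ℍ => z.im⁻¹) (fun z => ?_)
    (tendsto_inv_atTop_zero.comp tendsto_comap)
  rw [norm_inv]
  exact inv_anti₀ z.im_pos ((le_abs_self _).trans (Complex.abs_im_le_norm z))

lemma hasValues_E2 : HasValues 2 E2 1 1 := by
  have h1 : Tendsto E2 atImInfty (𝓝 1) := by
    have := tendsto_of_hasSum (f := E2)
      (c := fun m => if m = 0 then 1 else -24 * ArithmeticFunction.sigma 1 m) fun τ => by
        simpa only [Function.Periodic.qParam, Complex.ofReal_one, div_one, E2]
          using EisensteinSeries.hasSum_qExpansion_E2 (z := τ)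
    simpa using this
  refine ⟨h1, ?_⟩
  rw [E2, EisensteinSeries.E2_slash_action]
  have h2 : Tendsto ((1 / (2 * riemannZeta 2)) • EisensteinSeries.D2 ModularGroup.S) atImInfty
      (𝓝 0) := by
    have := (tendsto_inv_coe_atImInfty.const_mul (2 * Real.pi * Complex.I : ℂ)).const_smul
      (1 / (2 * riemannZeta 2))
    rw [mul_zero, smul_zero] at this
    refine this.congr fun z => ?_
    rw [Pi.smul_apply, EisensteinSeries.D2_S z, ← div_eq_mul_inv]
  have h3 := h1.sub h2
  rw [sub_zero] at h3
  exact h3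

lemma tendsto_E_atImInfty {k : ℕ} (hk : 3 ≤ k) (hk2 : Even k) :
    Tendsto (E hk) atImInfty (𝓝 1) := by
  have h0 := EisensteinSeries.E_qExpansion_coeff_zero hk hk2
  rw [← h0]
  exact tendsto_of_hasSum (c := fun m => (qExpansion 1 (E hk)).coeff m) fun τ =>
    hasSum_qExpansion one_pos
      (SlashInvariantFormClass.periodic_comp_ofComplex _ one_mem_strictPeriods_SL)
      (ModularFormClass.holo _) (ModularFormClass.bdd_at_infty _) τ

lemma hasValues_of_levelOne {k : ℤ} (f : ModularForm 𝒮ℒ k) {u : ℂ}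
    (hf : Tendsto f atImInfty (𝓝 u)) : HasValues k f u u := by
  refine ⟨hf, ?_⟩
  have h : ⇑f ∣[k] ModularGroup.S = f :=
    SlashInvariantFormClass.slash_action_eq f _ (MonoidHom.mem_range.mpr ⟨ModularGroup.S, rfl⟩)
  rwa [h]

lemma hasValues_E4 : HasValues 4 E4 1 1 :=
  hasValues_of_levelOne ModularForm.E₄ (tendsto_E_atImInfty _ ⟨2, rfl⟩)

lemma alpha2_eq : alpha2 = (1 / 240 : ℂ) • (E4 - levelRaise 2 E4) := by
  ext z
  simp [alpha2]
  ring

lemma C_two_eq : C 2 = (2 : ℂ) • levelRaise 2 E2 - E2 := by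
  ext z
  simp [C]

lemma C_four_eq : C 4 = (1 / 3 : ℂ) • ((4 : ℂ) • levelRaise 4 E2 - E2) := by
  ext z
  simp [C]
  ring

lemma alpha4_eq : alpha4 = (1 / 16 : ℂ) • (C 2 - C 4) := by
  ext z
  simp [alpha4]
  ring

lemma hasValues_alpha2 : HasValues 4 alpha2 0 (1 / 256) := by
  rw [alpha2_eq]
  convert (hasValues_E4.sub (hasValues_E4.levelRaise 2)).smul (1 / 240) using 1 <;> norm_num

lemma hasValues_C_two : HasValues 2 (C 2) 1 (-1 / 2) := by
  rw [C_two_eq]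
  convert ((hasValues_E2.levelRaise 2).smul 2).sub hasValues_E2 using 1 <;> norm_num

lemma hasValues_C_four : HasValues 2 (C 4) 1 (-1 / 4) := by
  rw [C_four_eq]
  convert (((hasValues_E2.levelRaise 4).smul 4).sub hasValues_E2).smul (1 / 3) using 1 <;> norm_num

lemma hasValues_alpha4 : HasValues 2 alpha4 0 (-1 / 64) := by
  rw [alpha4_eq]
  convert (hasValues_C_two.sub hasValues_C_four).smul (1 / 16) using 1 <;> norm_num

/-! ### Raising the level -/

lemma exists_restrict {Γ Γ' : Subgroup (GL (Fin 2) ℝ)} {k : ℤ} (h : Γ ≤ Γ')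
    (f : ModularForm Γ' k) : ∃ g : ModularForm Γ k, (g : ℍ → ℂ) = f :=
  ⟨{ toFun := f
     slash_action_eq' := fun γ hγ => f.slash_action_eq' γ (h hγ)
     holo' := f.holo'
     bdd_at_cusps' := fun hc => f.bdd_at_cusps' (hc.mono h) }, rfl⟩

/-- The matrix `diag(h, 1)`. -/
def diagReal (h : ℕ) [NeZero h] : GL (Fin 2) ℝ :=
  Matrix.GeneralLinearGroup.mkOfDetNeZero !![(h : ℝ), 0; 0, 1] (by simp [NeZero.ne h])

lemma diagReal_coe (h : ℕ) [NeZero h] :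
    (diagReal h : Matrix (Fin 2) (Fin 2) ℝ) = !![(h : ℝ), 0; 0, 1] := by
  ext i j
  fin_cases i <;> fin_cases j <;> simp [diagReal, Matrix.GeneralLinearGroup.mkOfDetNeZero]

lemma slash_diagReal (h : ℕ) [NeZero h] (k : ℤ) (f : ℍ → ℂ) :
    f ∣[k] diagReal h = (h : ℂ) ^ (k - 1) • levelRaise h f := by
  have h0 : (0 : ℝ) < h := Nat.cast_pos.mpr (Nat.pos_of_ne_zero (NeZero.ne h))
  have hdet : (diagReal h).det.val = h := by
    rw [Matrix.GeneralLinearGroup.val_det_apply, diagReal_coe]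
    simp
  have hd : ∀ z : ℍ, diagReal h • z = ⟨(h : ℂ) * z, by simpa using mul_pos h0 z.im_pos⟩ := by
    intro z
    ext
    rw [UpperHalfPlane.coe_smul_of_det_pos (by rw [hdet]; exact h0)]
    simp [num, denom, diagReal_coe]
  ext z
  rw [ModularForm.slash_apply, hd, hdet]
  simp [σ, hdet, h0, levelRaise, denom, diagReal_coe, mul_comm]

lemma exists_conj_diagReal {h N : ℕ} [NeZero h] {γ : SL(2, ℤ)} (hγ : γ ∈ Gamma0 (h * N)) :
    ∃ γ' ∈ Gamma0 N, diagReal h * mapGL ℝ γ = mapGL ℝ γ' * diagReal h ∧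
      γ 1 0 = h * γ' 1 0 ∧ γ' 1 1 = γ 1 1 := by
  rw [Gamma0_mem, ZMod.intCast_zmod_eq_zero_iff_dvd] at hγ
  obtain ⟨t, ht⟩ := hγ
  have hdet := γ.det_coe
  rw [Matrix.det_fin_two, ht] at hdet
  push_cast at hdet ht
  obtain ⟨γ', h00, h01, h10, h11⟩ : ∃ γ' : SL(2, ℤ),
      γ' 0 0 = γ 0 0 ∧ γ' 0 1 = h * γ 0 1 ∧ γ' 1 0 = N * t ∧ γ' 1 1 = γ 1 1 := by
    refine ⟨⟨!![γ 0 0, h * γ 0 1; N * t, γ 1 1], ?_⟩, rfl, rfl, rfl, rfl⟩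
    rw [Matrix.det_fin_two_of]
    linear_combination hdet
  refine ⟨γ', ?_, ?_, by rw [ht, h10, mul_assoc], h11⟩
  · rw [Gamma0_mem, h10]
    simp
  · ext i j
    fin_cases i <;> fin_cases j <;>
      simp [Matrix.mul_apply, Fin.sum_univ_two, diagReal_coe, mapGL_coe_matrix, ht, h00, h01, h10,
        h11, mul_comm, mul_left_comm]

open ConjAct Pointwise in
/-- If `f` is a modular form of level `N`, then `f(hz)` is one of level `hN`. -/
lemma exists_levelRaise {N : ℕ} [NeZero N] {k : ℤ} (h : ℕ) [NeZero h]
    (f : ModularForm (Gamma0 N : Subgroup (GL (Fin 2) ℝ)) k) :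
    ∃ g : ModularForm (Gamma0 (h * N) : Subgroup (GL (Fin 2) ℝ)) k,
      (g : ℍ → ℂ) = levelRaise h f := by
  have hle : (Gamma0 (h * N) : Subgroup (GL (Fin 2) ℝ)) ≤
      toConjAct (diagReal h)⁻¹ • (Gamma0 N : Subgroup (GL (Fin 2) ℝ)) := by
    rintro _ ⟨γ, hγ, rfl⟩
    obtain ⟨γ', hγ', hc, -⟩ := exists_conj_diagReal hγ
    rw [toConjAct_inv, Subgroup.mem_inv_pointwise_smul_iff, toConjAct_smul]
    change diagReal h * mapGL ℝ γ * (diagReal h)⁻¹ ∈ _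
    rw [hc, mul_inv_cancel_right]
    exact Subgroup.mem_map_of_mem _ hγ'
  obtain ⟨g, hg⟩ := exists_restrict hle (translate f (diagReal h))
  refine ⟨((h : ℂ) ^ (k - 1))⁻¹ • g, ?_⟩
  have h0 : (h : ℂ) ^ (k - 1) ≠ 0 := zpow_ne_zero _ (Nat.cast_ne_zero.mpr (NeZero.ne h))
  ext z
  rw [smul_apply, hg, ModularForm.coe_translate, slash_diagReal, Pi.smul_apply,
    smul_smul, inv_mul_cancel₀ h0, one_smul]

/-! ### The forms of weight two -/

/-- The quasimodular correction terms of `h E₂(hz)` and `E₂(z)` under `Γ₀(h)` are equal. -/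
lemma smul_levelRaise_E2_sub_slash (h : ℕ) [NeZero h] {γ : SL(2, ℤ)} (hγ : γ ∈ Gamma0 h) :
    ((h : ℂ) • levelRaise h E2 - E2) ∣[(2 : ℤ)] γ = (h : ℂ) • levelRaise h E2 - E2 := by
  obtain ⟨γ', -, hc, h10, h11⟩ := exists_conj_diagReal (h := h) (N := 1) (by rwa [mul_one])
  have hslash : ∀ f : ℍ → ℂ, f ∣[(2 : ℤ)] diagReal h = (h : ℂ) • levelRaise h f := fun f => by
    rw [slash_diagReal]
    norm_num
  have h1 : ((h : ℂ) • levelRaise h E2) ∣[(2 : ℤ)] γ =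
      (h : ℂ) • levelRaise h (E2 ∣[(2 : ℤ)] γ') := by
    rw [← hslash, ← hslash, SL_slash, SL_slash, ← SlashAction.slash_mul, ← SlashAction.slash_mul]
    exact congrArg (E2 ∣[(2 : ℤ)] ·) hc
  rw [sub_eq_add_neg, SlashAction.add_slash, SlashAction.neg_slash, h1, E2,
    EisensteinSeries.E2_slash_action, EisensteinSeries.E2_slash_action]
  ext z
  have hD : (h : ℂ) * levelRaise h (EisensteinSeries.D2 γ') z = EisensteinSeries.D2 γ z := by
    have hden : ∀ (g : SL(2, ℤ)) (w : ℂ), denom g w = g 1 0 * w + g 1 1 := fun g w => by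
      simp [denom]
    simp only [levelRaise, EisensteinSeries.D2, hden, h10, h11]
    push_cast
    ring
  simp only [Pi.add_apply, Pi.neg_apply, Pi.smul_apply, smul_eq_mul, levelRaise, Pi.sub_apply]
    at hD ⊢
  linear_combination (-(1 / (2 * riemannZeta 2))) * hD

/-- The group `Γ₀(2)` has only the two cusps infinity and zero. -/
lemma exists_eq_mul_S_mul_T_zpow {γ : SL(2, ℤ)} (hγ : γ ∉ Gamma0 2) :
    ∃ γ' ∈ Gamma0 2, ∃ j : ℤ, γ = γ' * ModularGroup.S * ModularGroup.T ^ j := by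
  refine ⟨γ * (ModularGroup.T ^ (γ 1 1))⁻¹ * ModularGroup.S⁻¹, ?_, γ 1 1, by group⟩
  have h : (γ * (ModularGroup.T ^ (γ 1 1))⁻¹ * ModularGroup.S⁻¹) 1 0 = γ 1 1 * (γ 1 0 - 1) := by
    have hS : ((ModularGroup.S⁻¹ : SL(2, ℤ)) : Matrix (Fin 2) (Fin 2) ℤ) = !![0, 1; -1, 0] := by
      decide
    rw [← zpow_neg, Matrix.SpecialLinearGroup.coe_mul,
      Matrix.SpecialLinearGroup.coe_mul, hS, ModularGroup.coe_T_zpow]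
    simp [Matrix.mul_apply, Fin.sum_univ_two]
    ring
  rw [Gamma0_mem, h]
  rw [Gamma0_mem] at hγ
  have : ∀ c d : ZMod 2, c ≠ 0 → d * (c - 1) = 0 := by decide
  push_cast
  exact this _ _ hγ

lemma exists_C_two : ∃ c : M 2 2, (c : ℍ → ℂ) = C 2 := by
  have hinv : ∀ γ ∈ Gamma0 2, C 2 ∣[(2 : ℤ)] γ = C 2 := fun γ hγ => by
    rw [C_two_eq]
    exact smul_levelRaise_E2_sub_slash 2 hγ
  have hdiff : MDiff (levelRaise 2 E2) := by
    have h := (E2_mdifferentiable.slash 2 (diagReal 2)).const_smul (1 / 2 : ℂ)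
    rw [slash_diagReal, smul_smul] at h
    norm_num at h
    exact h
  refine ⟨{ toFun := C 2
            slash_action_eq' := ?_
            holo' := ?_
            bdd_at_cusps' := ?_ }, rfl⟩
  · rintro _ ⟨γ, hγ, rfl⟩
    exact hinv γ hγ
  · change MDiff (C 2)
    rw [C_two_eq]
    exact (hdiff.const_smul 2).sub E2_mdifferentiable
  · intro x hx
    rw [Subgroup.IsArithmetic.isCusp_iff_isCusp_SL2Z] at hx
    rw [OnePoint.isBoundedAt_iff_forall_SL2Z hx]
    intro γ _
    change IsBoundedAtImInfty (C 2 ∣[(2 : ℤ)] γ)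
    by_cases hγ : γ ∈ Gamma0 2
    · rw [hinv γ hγ]
      exact hasValues_C_two.1.isBigO_one ℝ
    · obtain ⟨γ', hγ', j, rfl⟩ := exists_eq_mul_S_mul_T_zpow hγ
      rw [SlashAction.slash_mul, SlashAction.slash_mul, hinv γ' hγ']
      have hS : IsBoundedAtImInfty (C 2 ∣[(2 : ℤ)] ModularGroup.S) :=
        hasValues_C_two.2.isBigO_one ℝ
      refine hS.slash 2 (g := mapGL ℝ (ModularGroup.T ^ j)) ?_
      change (((ModularGroup.T ^ j : SL(2, ℤ)) 1 0 : ℤ) : ℝ) = 0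
      rw [ModularGroup.coe_T_zpow]
      simp

lemma C_four_eq_levelRaise :
    C 4 = (1 / 3 : ℂ) • ((2 : ℂ) • levelRaise 2 (C 2) + C 2) := by
  ext z
  have h : levelRaise 2 (levelRaise 2 E2) z = levelRaise 4 E2 z := by
    simp only [levelRaise]
    congr 1
    ext
    push_cast
    ring
  rw [C_four_eq, C_two_eq]
  simp only [Pi.smul_apply, Pi.add_apply, Pi.sub_apply, smul_eq_mul, ← h]
  simp only [levelRaise, Pi.smul_apply, Pi.sub_apply, smul_eq_mul]
  ring

lemma Gamma0_mul_le (h N : ℕ) : Gamma0 (h * N) ≤ Gamma0 N := fun γ hγ => by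
  rw [Gamma0_mem, ZMod.intCast_zmod_eq_zero_iff_dvd] at hγ ⊢
  exact (by exact_mod_cast dvd_mul_left N h : (N : ℤ) ∣ (h * N : ℕ)).trans hγ

/-! ### Generators -/

lemma eq_zero_of_odd {N k : ℕ} (hk : Odd k) (f : M N k) : f = 0 := by
  refine ModularForm.eq_zero_of_neg_one_mem (Subgroup.mem_map.mpr ⟨-1, ?_, ?_⟩)
    (by exact_mod_cast hk) f
  · simp [Gamma0_mem]
  · ext i j
    simp

section Generation

variable {N : ℕ} [NeZero N]

lemma exists_tendsto {k : ℤ} (f : ModularForm (Gamma0 N : Subgroup (GL (Fin 2) ℝ)) k) :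
    ∃ u, Tendsto f atImInfty (𝓝 u) := by
  have h := hasSum_qExpansion (f := f) one_pos
    (SlashInvariantFormClass.periodic_comp_ofComplex f (one_mem_strictPeriods_Gamma0 N))
    (ModularFormClass.holo f) (ModularFormClass.bdd_at_infty f)
  exact ⟨_, tendsto_of_hasSum (c := fun m => (qExpansion 1 f).coeff m) h⟩

/-- Induction on the weight: subtracting a multiple of a form with value 1 at infinity, one may
assume that `f` vanishes there, and then divide by `D`. -/
theorem eq_top_of_division {w : ℕ} (hw : 0 < w) (D : M N w) (hD0 : D ≠ 0)
    (hD : Tendsto D atImInfty (𝓝 0)) (hindex : w * Nat.card (Cosets N) ≤ 12)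
    (A : Subalgebra ℂ (GradedRing N)) (hDA : DirectSum.of (M N) w D ∈ A)
    (hA : ∀ k, 0 < k → (∀ f : M N k, f = 0) ∨
      ∃ P : M N k, DirectSum.of (M N) k P ∈ A ∧ Tendsto P atImInfty (𝓝 1)) : A = ⊤ := by
  have key : ∀ k (f : M N k), DirectSum.of (M N) k f ∈ A := by
    intro k
    induction k using Nat.strong_induction_on with
    | _ k ih =>
    intro f
    rcases Nat.eq_zero_or_pos k with rfl | hk
    · obtain ⟨c, hc⟩ := ModularForm.eq_const_of_weight_zero (ModularForm.mcast Nat.cast_zero f)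
      obtain ⟨g, hg, hgA⟩ := algebraMap_eq_of (N := N) c
      have : f = g := ModularForm.ext fun z => (congrFun hc z).trans (hg z).symm
      rw [this, ← hgA]
      exact A.algebraMap_mem c
    rcases hA k hk with h0 | ⟨P, hPA, hP⟩
    · rw [h0 f, map_zero]
      exact A.zero_mem
    obtain ⟨u, hu⟩ := exists_tendsto f
    have hzero : IsZeroAtImInfty (f - u • P : M N k) := by
      have := hu.sub (hP.const_smul u)
      simpa using! this
    obtain ⟨g, hg⟩ := exists_eq_mul_of_isZeroAtImInfty D hD0 hD (by exact_mod_cast hindex) _ hzero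
    have hmem : DirectSum.of (M N) k (f - u • P) ∈ A := by
      rcases lt_or_ge k w with hlt | hge
      · have hg0 : g = 0 := ModularForm.isZero_of_neg_weight (by omega) g
        have : f - u • P = 0 := ModularForm.ext fun z => by rw [hg, hg0]; exact mul_zero _
        rw [this, map_zero]
        exact A.zero_mem
      · let g' : M N (k - w) := ModularForm.mcast (by omega) g
        obtain ⟨p, hp, hpA⟩ := exists_of_eq_mul D g'
        have hfp : DirectSum.of (M N) k (f - u • P) = DirectSum.of (M N) (w + (k - w)) p :=
          DirectSum.of_eq_of_gradedMonoid_eq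
            (gradedMonoid_ext (by change k = w + (k - w); omega) fun z => (hg z).trans (hp z).symm)
        rw [hfp, hpA]
        exact A.mul_mem hDA (ih _ (by omega) g')
    have hf : DirectSum.of (M N) k f =
        DirectSum.of (M N) k (f - u • P) + u • DirectSum.of (M N) k P := by
      rw [← DirectSum.of_smul, ← map_add, sub_add_cancel]
    rw [hf]
    exact A.add_mem hmem (A.smul_mem hPA u)
  refine eq_top_iff.mpr fun x _ => ?_
  induction x using DirectSum.induction_on with
  | zero => exact A.zero_mem
  | of k f => exact key k f
  | add x y hx hy => exact A.add_mem (hx trivial) (hy trivial)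

/-- The forms `c ^ n` provide forms of every even weight with value 1 at infinity. -/
theorem eq_top_of_weight_two {w : ℕ} (hw : 0 < w) (D : M N w) (hD0 : D ≠ 0)
    (hD : Tendsto D atImInfty (𝓝 0)) (hindex : w * Nat.card (Cosets N) ≤ 12)
    (A : Subalgebra ℂ (GradedRing N)) (hDA : DirectSum.of (M N) w D ∈ A)
    (c : M N 2) (hc : Tendsto c atImInfty (𝓝 1)) (hcA : DirectSum.of (M N) 2 c ∈ A) : A = ⊤ := by
  refine eq_top_of_division hw D hD0 hD hindex A hDA fun k _ => ?_
  rcases Nat.even_or_odd' k with ⟨n, rfl | rfl⟩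
  · rw [mul_comm]
    obtain ⟨P, hP, hPA⟩ := exists_of_eq_pow c n
    refine .inr ⟨P, hPA ▸ A.pow_mem hcA n, ?_⟩
    simpa [← hP] using hc.pow n
  · exact .inl (eq_zero_of_odd ⟨n, rfl⟩)

end Generation

lemma HasValues.eq_of_pow_eq {a b : ℕ} {f g : ℍ → ℂ} {u v u' v' c : ℂ} (hf : HasValues a f u v)
    (hg : HasValues b g u' v') (h : f ^ b = c • g ^ a) :
    u ^ b = c * u' ^ a ∧ v ^ b = c * v' ^ a := by
  have h1 := hf.pow b
  have h2 := (hg.pow a).smul c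
  rw [h, mul_comm] at h1
  exact h1.eq h2

lemma HasValues.ne_zero {k : ℤ} {f : ℍ → ℂ} {u v : ℂ} (hf : HasValues k f u v) (hv : v ≠ 0) :
    f ≠ 0 := by
  rintro rfl
  have h := hf.smul 0
  rw [smul_zero, zero_mul, zero_mul] at h
  exact hv (hf.eq h).2

lemma card_cosets_one_le : Nat.card (Cosets 1) ≤ 1 :=
  card_quotient_Gamma0_le ![1] fun _ _ _ _ _ => ⟨0, Subsingleton.elim _ _⟩

lemma card_cosets_two_le : Nat.card (Cosets 2) ≤ 3 :=
  card_quotient_Gamma0_le ![1, ⟨!![0, -1; 1, 0], by simp⟩, ⟨!![0, -1; 1, 1], by simp⟩] (by decide)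

lemma card_cosets_four_le : Nat.card (Cosets 4) ≤ 6 :=
  card_quotient_Gamma0_le ![1, ⟨!![0, -1; 1, 0], by simp⟩, ⟨!![0, -1; 1, 1], by simp⟩,
    ⟨!![0, -1; 1, 2], by simp⟩, ⟨!![0, -1; 1, 3], by simp⟩, ⟨!![1, 0; 2, 1], by simp⟩] (by decide)

/-! ### Levels one, two and four -/

lemma exists_of_levelOne (N k : ℕ) (f : ModularForm 𝒮ℒ k) : ∃ g : M N k, (g : ℍ → ℂ) = f :=
  exists_restrict (by rintro _ ⟨γ, -, rfl⟩; exact ⟨γ, rfl⟩) f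

lemma Gamma0_one_eq : (Gamma0 1 : Subgroup (GL (Fin 2) ℝ)) = 𝒮ℒ := by
  rw [show Gamma0 1 = ⊤ from eq_top_iff.mpr fun γ _ => Gamma0_mem.mpr (Subsingleton.elim _ _),
    MonoidHom.range_eq_map]

lemma eq_zero_of_weight_two (f : M 1 2) : f = 0 := by
  have h := ModularForm.dimension_level_one 2 ⟨1, rfl⟩
  rw [if_pos (Nat.ModEq.refl 2)] at h
  have h0 := rank_zero_iff_forall_zero.mp (by simpa using h)
    (ModularForm.mcast rfl f Gamma0_one_eq.symm)
  exact ModularForm.ext fun z => DFunLike.congr_fun h0 z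

lemma ne_zero_of_hasValues {N k : ℕ} {f : M N k} {h : ℍ → ℂ} {u v : ℂ} (hf : ⇑f = h)
    (hh : HasValues k h u v) (hv : v ≠ 0) : f ≠ 0 := by
  rintro rfl
  exact hh.ne_zero hv hf.symm

theorem levelOne : ∃ (e4 : M 1 4) (e6 : M 1 6), ⇑e4 = E4 ∧ ⇑e6 = E6 ∧
    IsGradedPolynomialRing 1 e4 e6 := by
  obtain ⟨e4, he4⟩ := exists_of_levelOne 1 4 ModularForm.E₄
  obtain ⟨e6, he6⟩ := exists_of_levelOne 1 6 ModularForm.E₆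
  have h4 : Tendsto e4 atImInfty (𝓝 1) := he4 ▸ tendsto_E_atImInfty _ ⟨2, rfl⟩
  have h6 : Tendsto e6 atImInfty (𝓝 1) := he6 ▸ tendsto_E_atImInfty _ ⟨3, rfl⟩
  have hΔ : ∀ z, e4 z ^ 3 - e6 z ^ 2 = 1728 * discriminant z := fun z => by
    rw [he4, he6, discriminant_eq_E₄_cube_sub_E₆_sq]
    ring
  refine ⟨e4, e6, he4, he6, isGradedPolynomialRing_of_generated_eq_top (by norm_num) e4 e6 ?_ ?_ ?_⟩
  · have m4 : DirectSum.of (M 1) 4 e4 ∈ generated 1 e4 e6 := Algebra.subset_adjoin (.inl rfl)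
    have m6 : DirectSum.of (M 1) 6 e6 ∈ generated 1 e4 e6 := Algebra.subset_adjoin (.inr rfl)
    obtain ⟨p, hp, hpA⟩ := exists_of_eq_pow e4 3
    obtain ⟨q, hq, hqA⟩ := exists_of_eq_pow e6 2
    have hD : ∀ z, (p - q : M 1 12) z = 1728 * discriminant z := fun z => by
      rw [← hΔ, ← hp, ← hq]
      rfl
    refine eq_top_of_division (w := 12) (by norm_num) (p - q) ?_ ?_ ?_ _ ?_ fun k hk => ?_
    · intro h
      have := hD I
      rw [h] at this
      exact mul_ne_zero (by norm_num) (discriminant_ne_zero I) this.symm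
    · have := (h4.pow 3).sub (h6.pow 2)
      rw [one_pow, one_pow, sub_self] at this
      exact this.congr fun z => (hΔ z).trans (hD z).symm
    · linarith [card_cosets_one_le]
    · rw [map_sub]
      refine sub_mem ?_ ?_
      · exact hpA ▸ pow_mem m4 3
      · exact hqA ▸ pow_mem m6 2
    · rcases Nat.even_or_odd k with hk2 | hk2
      · rcases eq_or_ne k 2 with rfl | hk'
        · exact .inl eq_zero_of_weight_two
        obtain ⟨i, j, rfl⟩ : ∃ i j, k = i * 4 + j * 6 := by
          obtain ⟨m, rfl⟩ := hk2
          rcases Nat.even_or_odd' m with ⟨n, rfl | rfl⟩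
          · exact ⟨n, 0, by ring⟩
          · exact ⟨n - 1, 1, by omega⟩
        obtain ⟨p, hp, hpA⟩ := exists_of_eq_pow e4 i
        obtain ⟨q, hq, hqA⟩ := exists_of_eq_pow e6 j
        obtain ⟨r, hr, hrA⟩ := exists_of_eq_mul p q
        refine .inr ⟨r, ?_, ?_⟩
        · rw [hrA, hpA, hqA]
          exact mul_mem (pow_mem m4 i) (pow_mem m6 j)
        · have := (h4.pow i).mul (h6.pow j)
          simpa [← hp, ← hq, ← hr] using this
      · exact .inl (eq_zero_of_odd hk2)
  · rintro rfl
    exact one_ne_zero (tendsto_nhds_unique h6 tendsto_const_nhds)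
  · intro c hc
    have hcz : ∀ z, e4 z ^ 6 = c * e6 z ^ 4 := congrFun hc
    have hc1 : c = 1 := by
      have := tendsto_nhds_unique ((h4.pow 6).congr hcz) ((h6.pow 4).const_mul c)
      simpa using this.symm
    -- `(E₄³ - E₆²) (E₄³ + E₆²) = 0`, and the first factor has no zeros.
    have hadd : ∀ z, e4 z ^ 3 + e6 z ^ 2 = 0 := fun z => by
      have h1 : (e4 z ^ 3 - e6 z ^ 2) * (e4 z ^ 3 + e6 z ^ 2) = 0 := by
        have := hcz z
        rw [hc1] at this
        linear_combination this
      rw [hΔ] at h1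
      exact (mul_eq_zero.mp h1).resolve_left
        (mul_ne_zero (by norm_num) (discriminant_ne_zero z))
    have := tendsto_nhds_unique (((h4.pow 3).add (h6.pow 2)).congr hadd) tendsto_const_nhds
    norm_num at this

theorem levelTwo : ∃ (c2 : M 2 2) (a2 : M 2 4) (e4 : M 2 4),
    ⇑c2 = C 2 ∧ ⇑a2 = alpha2 ∧ ⇑e4 = E4 ∧
    IsGradedPolynomialRing 2 c2 a2 ∧ IsGradedPolynomialRing 2 c2 e4 ∧
    generated 2 c2 a2 = generated 2 c2 e4 := by
  obtain ⟨c2, hc2⟩ := exists_C_two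
  obtain ⟨e4, he4⟩ := exists_of_levelOne 2 4 ModularForm.E₄
  obtain ⟨e, he⟩ := exists_of_levelOne 1 4 ModularForm.E₄
  obtain ⟨e', he'⟩ := exists_levelRaise 2 e
  let a2 : M 2 4 := (1 / 240 : ℂ) • (e4 - e' : M 2 4)
  have ha2 : ⇑a2 = alpha2 := by
    rw [alpha2_eq]
    change (1 / 240 : ℂ) • (⇑e4 - ⇑e') = _
    rw [he4, he', he]
    rfl
  have ha2_ne : a2 ≠ 0 := ne_zero_of_hasValues ha2 hasValues_alpha2 (by norm_num)
  have hlimC : Tendsto c2 atImInfty (𝓝 1) := hc2 ▸ hasValues_C_two.1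
  have hlimA : Tendsto a2 atImInfty (𝓝 0) := ha2 ▸ hasValues_alpha2.1
  have hindex : 4 * Nat.card (Cosets 2) ≤ 12 := by linarith [card_cosets_two_le]
  have htop : ∀ A : Subalgebra ℂ (GradedRing 2), DirectSum.of (M 2) 2 c2 ∈ A →
      DirectSum.of (M 2) 4 a2 ∈ A → A = ⊤ := fun A h1 h2 =>
    eq_top_of_weight_two (by norm_num) a2 ha2_ne hlimA hindex A h2 c2 hlimC h1
  have hgenA : generated 2 c2 a2 = ⊤ :=
    htop _ (Algebra.subset_adjoin (.inl rfl)) (Algebra.subset_adjoin (.inr rfl))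
  have hgenE : generated 2 c2 e4 = ⊤ := by
    have m2 : DirectSum.of (M 2) 2 c2 ∈ generated 2 c2 e4 := Algebra.subset_adjoin (.inl rfl)
    have m4 : DirectSum.of (M 2) 4 e4 ∈ generated 2 c2 e4 := Algebra.subset_adjoin (.inr rfl)
    refine htop _ m2 ?_
    -- `E₄ - C₂²` vanishes at infinity, so it is a multiple of `α₂`; the factor 192 comes from
    -- the values `1 - 1/4` and `1/256` at the cusp `0`.
    obtain ⟨p, hp, hpA⟩ := exists_of_eq_pow c2 2
    have hval : HasValues 4 (E4 - C 2 ^ 2) (1 - 1 ^ 2) (1 - (-1 / 2) ^ 2) :=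
      hasValues_E4.sub (hasValues_C_two.pow 2)
    have hdiff : ⇑(e4 - p : M 2 4) = E4 - C 2 ^ 2 := by
      ext z
      change e4 z - p z = _
      rw [hp, he4, hc2]
      rfl
    have hzero : IsZeroAtImInfty (e4 - p : M 2 4) := by
      rw [hdiff]
      simpa using! hval.1
    obtain ⟨g, hg⟩ := exists_eq_mul_of_isZeroAtImInfty a2 ha2_ne hlimA
      (by exact_mod_cast hindex) _ hzero
    obtain ⟨c, hc⟩ := ModularForm.eq_const_of_weight_zero (ModularForm.mcast (sub_self _) g)
    have hmul : E4 - C 2 ^ 2 = c • alpha2 := by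
      ext z
      have hcz : g z = c := congrFun hc z
      rw [← hdiff, hg, hcz, ha2, mul_comm]
      rfl
    have hc192 : c = 192 := by
      rw [hmul] at hval
      have := (hval.eq (hasValues_alpha2.smul c)).2
      linear_combination -256 * this
    have ha : a2 = (1 / 192 : ℂ) • (e4 - p : M 2 4) := by
      refine ModularForm.ext fun z => ?_
      change a2 z = (1 / 192 : ℂ) * (e4 - p : M 2 4) z
      rw [hdiff, hmul, hc192, ha2, Pi.smul_apply, smul_eq_mul]
      ring
    rw [ha, DirectSum.of_smul, map_sub]
    refine Subalgebra.smul_mem _ (sub_mem m4 ?_) _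
    exact hpA ▸ pow_mem m2 2
  refine ⟨c2, a2, e4, hc2, ha2, he4,
    isGradedPolynomialRing_of_generated_eq_top (by norm_num) c2 a2 hgenA ha2_ne fun c h => ?_,
    isGradedPolynomialRing_of_generated_eq_top (by norm_num) c2 e4 hgenE
      (ne_zero_of_hasValues he4 hasValues_E4 (by norm_num)) fun c h => ?_,
    hgenA.trans hgenE.symm⟩
  · rw [hc2, ha2] at h
    have := (hasValues_C_two.eq_of_pow_eq (a := 2) (b := 4) hasValues_alpha2 h).1
    norm_num at this
  · rw [hc2, show ⇑e4 = E4 from he4] at h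
    obtain ⟨h1, h2⟩ := hasValues_C_two.eq_of_pow_eq (a := 2) (b := 4) hasValues_E4 h
    norm_num at h1 h2
    rw [← h1] at h2
    norm_num at h2

theorem levelFour : ∃ (c2 : M 4 2) (a4 : M 4 2) (c4 : M 4 2),
    ⇑c2 = C 2 ∧ ⇑a4 = alpha4 ∧ ⇑c4 = C 4 ∧
    IsGradedPolynomialRing 4 c2 a4 ∧ IsGradedPolynomialRing 4 c2 c4 ∧
    generated 4 c2 a4 = generated 4 c2 c4 := by
  obtain ⟨c, hc⟩ := exists_C_two
  obtain ⟨c', hc'⟩ := exists_levelRaise 2 c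
  obtain ⟨c2, hc2⟩ : ∃ c2 : M 4 2, ⇑c2 = C 2 := by
    rw [← hc]
    exact exists_restrict (Subgroup.map_mono (Gamma0_mul_le 2 2)) c
  let c4 : M 4 2 := (1 / 3 : ℂ) • ((2 : ℂ) • (c' : M 4 2) + c2 : M 4 2)
  have hc4 : ⇑c4 = C 4 := by
    rw [C_four_eq_levelRaise]
    change (1 / 3 : ℂ) • ((2 : ℂ) • ⇑c' + ⇑c2) = _
    rw [hc', hc, hc2]
  let a4 : M 4 2 := (1 / 16 : ℂ) • (c2 - c4 : M 4 2)
  have ha4 : ⇑a4 = alpha4 := by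
    rw [alpha4_eq, ← hc2, ← hc4]
    rfl
  have ha4_ne : a4 ≠ 0 := ne_zero_of_hasValues ha4 hasValues_alpha4 (by norm_num)
  have hlimC : Tendsto c2 atImInfty (𝓝 1) := hc2 ▸ hasValues_C_two.1
  have hlimA : Tendsto a4 atImInfty (𝓝 0) := ha4 ▸ hasValues_alpha4.1
  have htop : ∀ A : Subalgebra ℂ (GradedRing 4), DirectSum.of (M 4) 2 c2 ∈ A →
      DirectSum.of (M 4) 2 a4 ∈ A → A = ⊤ := fun A h1 h2 =>
    eq_top_of_weight_two (by norm_num) a4 ha4_ne hlimA (by linarith [card_cosets_four_le]) A h2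
      c2 hlimC h1
  have hgenA : generated 4 c2 a4 = ⊤ :=
    htop _ (Algebra.subset_adjoin (.inl rfl)) (Algebra.subset_adjoin (.inr rfl))
  have hgenC : generated 4 c2 c4 = ⊤ := by
    have m2 : DirectSum.of (M 4) 2 c2 ∈ generated 4 c2 c4 := Algebra.subset_adjoin (.inl rfl)
    have m4 : DirectSum.of (M 4) 2 c4 ∈ generated 4 c2 c4 := Algebra.subset_adjoin (.inr rfl)
    refine htop _ m2 ?_
    rw [DirectSum.of_smul, map_sub]
    exact Subalgebra.smul_mem _ (sub_mem m2 m4) _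
  refine ⟨c2, a4, c4, hc2, ha4, hc4,
    isGradedPolynomialRing_of_generated_eq_top (by norm_num) c2 a4 hgenA ha4_ne fun t h => ?_,
    isGradedPolynomialRing_of_generated_eq_top (by norm_num) c2 c4 hgenC
      (ne_zero_of_hasValues hc4 hasValues_C_four (by norm_num)) fun t h => ?_,
    hgenA.trans hgenC.symm⟩
  · rw [hc2, ha4] at h
    have := (hasValues_C_two.eq_of_pow_eq (a := 2) (b := 2) hasValues_alpha4 h).1
    norm_num at this
  · rw [hc2, hc4] at h
    obtain ⟨h1, h2⟩ := hasValues_C_two.eq_of_pow_eq (a := 2) (b := 2) hasValues_C_four h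
    norm_num at h1 h2
    rw [← h1] at h2
    norm_num at h2

end SmallLevel

end

theorem theorem1 :
    (∃ (e4 : SmallLevel.M 1 4) (e6 : SmallLevel.M 1 6),
      ⇑e4 = SmallLevel.E4 ∧ ⇑e6 = SmallLevel.E6 ∧
      SmallLevel.IsGradedPolynomialRing 1 e4 e6) ∧
    (∃ (c2 : SmallLevel.M 2 2) (a2 : SmallLevel.M 2 4) (e4 : SmallLevel.M 2 4),
      ⇑c2 = SmallLevel.C 2 ∧ ⇑a2 = SmallLevel.alpha2 ∧ ⇑e4 = SmallLevel.E4 ∧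
      SmallLevel.IsGradedPolynomialRing 2 c2 a2 ∧
      SmallLevel.IsGradedPolynomialRing 2 c2 e4 ∧
      SmallLevel.generated 2 c2 a2 = SmallLevel.generated 2 c2 e4) ∧
    (∃ (c2 : SmallLevel.M 4 2) (a4 : SmallLevel.M 4 2) (c4 : SmallLevel.M 4 2),
      ⇑c2 = SmallLevel.C 2 ∧ ⇑a4 = SmallLevel.alpha4 ∧ ⇑c4 = SmallLevel.C 4 ∧
      SmallLevel.IsGradedPolynomialRing 4 c2 a4 ∧
      SmallLevel.IsGradedPolynomialRing 4 c2 c4 ∧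
      SmallLevel.generated 4 c2 a4 = SmallLevel.generated 4 c2 c4) :=
  ⟨SmallLevel.levelOne, SmallLevel.levelTwo, SmallLevel.levelFour⟩
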